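/- Let $n,m,p\ge 0$ be integers, let $A_0,A_1,\dots,A_p\in\mathbb R^{n\times n}$ and $B\in\mathbb R^{n\times m}$, let $\mathcal P\subset\mathbb R^p$ be a polytope (the convex hull of finitely many points), and put $A(\rho)=A_0+\sum_{j=1}^p\rho_jA_j$. For $\rho\in\mathcal P$ let $$\mathcal K_\rho=\{K\in\mathbb R^{m\times n}:\ \text{every eigenvalue } \lambda\in\mathbb C \text{ of } A(\rho)-BK \text{ satisfies } \operatorname{Re}\lambda<0\},\qquad \mathcal K_{\mathcal P}=\bigcap_{\rho\in\mathcal P}\mathcal K_\rho .$$ Let $\mathcal C=\prod_{i=1}^{mn}[\underline C_i,\overline C_i]\subseteq\mathbb R^{mn}$ be a hyperrectangle, and let $\operatorname{vec}:\mathbb R^{m\times n}\to\mathbb R^{mn}$ be the vectorization (stacking of columns). Write $\det(sI-(A(\rho)-BK))=s^n+c_1s^{n-1}+\dots+c_n$, where $c_k=c_k(K,\rho)$, and set $c_0=1$ and $c_k=0$ for $k>n$. Define the division-free Routh table by $\tilde R_{1,j}=c_{2j-2}$, $\tilde R_{2,j}=c_{2j-1}$ and $$\tilde R_{i,j}=\tilde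 R_{i-1,1}\tilde R_{i-2,j+1}-\tilde R_{i-2,1}\tilde R_{i-1,j+1}\qquad(i\ge 3,\ j\ge 1),$$ and define the Routh–Hurwitz polynomials $f_i(K,\rho)=\tilde R_{i+1,1}$ for $1\le i\le n-1$ (so $f_1=c_1$ if $n\ge2$) and $f_n(K,\rho)=c_n$. Suppose that for every $i=1,\dots,n$ the optimization problem $$d_i=\inf\bigl\{\|K_{\mathcal C}-K_{\mathcal P}\|_F:\ K_{\mathcal P},K_{\mathcal C}\in\mathbb R^{m\times n},\ \rho\in\mathbb R^p,\ f_i(K_{\mathcal P},\rho)\le 0,\ \operatorname{vec}(K_{\mathcal C})\in\mathcal C,\ \rho\in\mathcal P\bigr\}$$ is feasible and has a strictly positive optimal value $d_i>0$. Then $\mathcal C\subseteq\operatorname{vec}(\mathcal K_{\mathcal P})$. -/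

import Mathlib

namespace LPVGain

noncomputable section

/-- A polytopic linear parameter-varying system `ẋ = A(ρ) x + B u` with `n` states, `m` inputs and
`p` parameters: `A(ρ) = A₀ + ∑ⱼ ρⱼ Aⱼ` and the parameter set `P` is a (convex, compact) polytope,
i.e. the convex hull of finitely many points. -/
structure PolytopicLPV (n m p : ℕ) where
  A₀ : Matrix (Fin n) (Fin n) ℝ
  Ac : Fin p → Matrix (Fin n) (Fin n) ℝ
  B : Matrix (Fin n) (Fin m) ℝ
  P : Set (Fin p → ℝ)
  isPolytope : ∃ V : Set (Fin p → ℝ), V.Finite ∧ P = convexHull ℝ V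

variable {n m p : ℕ}

/-- The system matrix `A(ρ)`. -/
def PolytopicLPV.A (S : PolytopicLPV n m p) (ρ : Fin p → ℝ) : Matrix (Fin n) (Fin n) ℝ :=
  S.A₀ + ∑ j, ρ j • S.Ac j

/-- The closed-loop matrix `A(ρ) - B K`. -/
def PolytopicLPV.closedLoop (S : PolytopicLPV n m p) (K : Matrix (Fin m) (Fin n) ℝ)
    (ρ : Fin p → ℝ) : Matrix (Fin n) (Fin n) ℝ :=
  S.A ρ - S.B * K

/-- All complex eigenvalues of the real matrix `M` have negative real part. -/
def IsHurwitz (M : Matrix (Fin n) (Fin n) ℝ) : Prop :=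
  ∀ z ∈ spectrum ℂ (M.map Complex.ofReal), z.re < 0

/-- The stability region `K_ρ`. -/
def PolytopicLPV.stabilityRegion (S : PolytopicLPV n m p) (ρ : Fin p → ℝ) :
    Set (Matrix (Fin m) (Fin n) ℝ) :=
  {K | IsHurwitz (S.closedLoop K ρ)}

/-- The robust stability region `K_P = ⋂_{ρ ∈ P} K_ρ`. -/
def PolytopicLPV.robustRegion (S : PolytopicLPV n m p) : Set (Matrix (Fin m) (Fin n) ℝ) :=
  ⋂ ρ ∈ S.P, S.stabilityRegion ρ

/-- The hyperrectangle `∏ᵢ [lo i, hi i]` in the space of vectorized gains. `Matrix.vec` (stacking of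
columns) takes values in `Fin n × Fin m → ℝ`. -/
def hyperrectangle (lo hi : Fin n × Fin m → ℝ) : Set (Fin n × Fin m → ℝ) :=
  Set.univ.pi fun i => Set.Icc (lo i) (hi i)

/-- The coefficient `c_k` in `det (sI - M) = sⁿ + c₁ sⁿ⁻¹ + ⋯ + cₙ` (with `c₀ = 1`); missing
coefficients (`k > n`) are zero. -/
def charCoeff (M : Matrix (Fin n) (Fin n) ℝ) (k : ℕ) : ℝ :=
  if k ≤ n then M.charpoly.coeff (n - k) else 0

/-- The division-free Routh table of the coefficient sequence `c`. Rows and columns are counted from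
zero: `routhTable c i j` is the entry `R̃_{i+1,j+1}` of the usual one-based table. -/
def routhTable (c : ℕ → ℝ) : ℕ → ℕ → ℝ
  | 0, j => c (2 * j)
  | 1, j => c (2 * j + 1)
  | i + 2, j =>
      routhTable c (i + 1) 0 * routhTable c i (j + 1) -
        routhTable c i 0 * routhTable c (i + 1) (j + 1)

/-- The Routh–Hurwitz polynomials `f₁ = c₁, f₂ = R̃_{3,1}, …, f_{n-1} = R̃_{n,1}, fₙ = cₙ` of the
closed loop; the index `i : Fin n` stands for `f_{i+1}`. -/
def PolytopicLPV.routhPoly (S : PolytopicLPV n m p) (i : Fin n) (K : Matrix (Fin m) (Fin n) ℝ)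
    (ρ : Fin p → ℝ) : ℝ :=
  if (i : ℕ) + 1 = n then charCoeff (S.closedLoop K ρ) n
  else routhTable (charCoeff (S.closedLoop K ρ)) ((i : ℕ) + 1) 0

section Frobenius

attribute [local instance] Matrix.frobeniusNormedAddCommGroup

/-- The Frobenius norm. -/
def frobNorm (M : Matrix (Fin m) (Fin n) ℝ) : ℝ := ‖M‖

end Frobenius

/-- The feasible set of the `i`-th problem: triples `(K_P, K_C, ρ)` with `fᵢ(K_P, ρ) ≤ 0`,
`vec K_C ∈ C` and `ρ ∈ P`. -/
def PolytopicLPV.feasibleSet (S : PolytopicLPV n m p) (C : Set (Fin n × Fin m → ℝ)) (i : Fin n) :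
    Set (Matrix (Fin m) (Fin n) ℝ × Matrix (Fin m) (Fin n) ℝ × (Fin p → ℝ)) :=
  {z | S.routhPoly i z.1 z.2.2 ≤ 0 ∧ z.2.1.vec ∈ C ∧ z.2.2 ∈ S.P}

/-- The optimal value `dᵢ`: the infimum of `‖K_C - K_P‖_F` over the feasible set (meaningful when
that set is nonempty; the objective is bounded below by zero). -/
def PolytopicLPV.optValue (S : PolytopicLPV n m p) (C : Set (Fin n × Fin m → ℝ)) (i : Fin n) : ℝ :=
  sInf ((fun z => frobNorm (z.2.1 - z.1)) '' S.feasibleSet C i)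

end

end LPVGain

/-!
Each row of the Routh table encodes one division step: a polynomial `P` of degree `N + 1` is
replaced by a polynomial `Q` of degree `N` whose own Routh table is that of `P` without its first
row. If `Q` has all its roots in the open left half-plane, then `|Q(-z)| ≤ |Q(z)|` for `Re z ≥ 0`.
Writing `P` as a combination of `Q(z)` and `Q(-z)`, a zero of `P` with `Re z ≥ 0` would force
`|1 + w| |Q(z)| = |w - 1| |Q(-z)|` for some `w` with `Re w > 0`, hence `|w - 1| < |1 + w|`, a
contradiction. Induction on the degree gives the sufficiency half of the Routh–Hurwitz criterion.

A gain `K` in the set `C` violating the `i`-th inequality at an admissible parameter is itself at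
distance zero from `C`, so positivity of `dᵢ` says that no gain in `C` violates it.
-/

namespace LPVGain

open Polynomial ComplexConjugate

section DescendingPolynomials

variable {R : Type*}

/-- The polynomial `c₀ Xᴺ + c₁ Xᴺ⁻¹ + ⋯ + c_N`, with coefficients listed from the top as in the
Routh table; its degree drops below `N` when `c₀ = 0`. -/
noncomputable def descPoly [Semiring R] (N : ℕ) (c : ℕ → R) : R[X] :=
  ∑ k ∈ Finset.range (N + 1), C (c k) * X ^ (N - k)

theorem descPoly_zero [Semiring R] (c : ℕ → R) : descPoly 0 c = C (c 0) := by
  simp [descPoly]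

theorem descPoly_succ [Semiring R] (N : ℕ) (c : ℕ → R) :
    descPoly (N + 1) c = descPoly N c * X + C (c (N + 1)) := by
  rw [descPoly, Finset.sum_range_succ, descPoly, Finset.sum_mul]
  congr 1
  · refine Finset.sum_congr rfl fun k hk => ?_
    rw [Nat.succ_sub (Nat.lt_succ_iff.1 (Finset.mem_range.1 hk)), pow_succ, mul_assoc]
  · simp

theorem descPoly_coeff_natDegree_sub [Semiring R] (q : R[X]) :
    descPoly q.natDegree (fun k => q.coeff (q.natDegree - k)) = q := by
  conv_rhs => rw [q.as_sum_range_C_mul_X_pow, ← Finset.sum_range_reflect]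
  simp only [descPoly, Nat.add_sub_cancel]

/-- One step of the division-free Routh scheme: the coefficient sequence whose Routh table is the
Routh table of `c` without its first row. Its even terms are the second row of that table and its
odd terms the third. -/
def routhReduce [Ring R] (c : ℕ → R) (k : ℕ) : R :=
  if Even k then c (k + 1) else c 1 * c (k + 1) - c 0 * c (k + 2)

theorem routhReduce_of_even [Ring R] (c : ℕ → R) {k : ℕ} (hk : Even k) :
    routhReduce c k = c (k + 1) :=
  if_pos hk

theorem routhReduce_of_odd [Ring R] (c : ℕ → R) {k : ℕ} (hk : Odd k) :
    routhReduce c k = c 1 * c (k + 1) - c 0 * c (k + 2) :=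
  if_neg (Nat.not_even_iff_odd.2 hk)

/- With `Q = descPoly N (routhReduce c)`, the sums of the terms of `Q` of even and of odd index are
`Qₑ, Qₒ = (Q(X) ± (-1) ^ N Q(-X)) / 2`, and this is twice the division step
`c₁ P = (c₁ + c₀ X) Qₑ + Qₒ`; the last term is the error from truncating `c` after `N + 1`. -/
theorem two_mul_descPoly_succ [CommRing R] (N : ℕ) (c : ℕ → R) :
    2 * C (c 1) * descPoly (N + 1) c =
      (1 + (C (c 1) + C (c 0) * X)) * descPoly N (routhReduce c) +
        ((C (c 1) + C (c 0) * X) - 1) * ((-1) ^ N * (descPoly N (routhReduce c)).comp (-X)) +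
        2 * C (c 0) * C (if Even N then 0 else c (N + 2)) := by
  induction N with
  | zero =>
    simp only [descPoly_succ, descPoly_zero, routhReduce_of_even c Even.zero, C_comp, Even.zero,
      if_true, C_0, pow_zero, zero_add]
    ring
  | succ N ih =>
    rw [descPoly_succ (N + 1) c, descPoly_succ N (routhReduce c)]
    simp only [add_comp, mul_comp, X_comp, C_comp, pow_succ]
    rcases Nat.even_or_odd N with hN | hN
    · simp only [hN, if_true, C_0] at ih
      simp only [hN.add_one, Nat.not_even_iff_odd.2 hN.add_one, routhReduce_of_odd, if_false,
        hN.neg_one_pow, C_sub, C_mul] at ih ⊢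
      linear_combination X * ih
    · simp only [Nat.not_even_iff_odd.2 hN, if_false] at ih
      simp only [hN.add_one, routhReduce_of_even, if_true, hN.neg_one_pow, C_0] at ih ⊢
      linear_combination X * ih

end DescendingPolynomials

theorem routhTable_routhReduce (c : ℕ → ℝ) (i j : ℕ) :
    routhTable (routhReduce c) i j = routhTable c (i + 1) j := by
  induction i using Nat.twoStepInduction generalizing j with
  | zero => simp [routhTable, routhReduce]
  | one =>
    rw [routhTable, routhReduce_of_odd c (odd_two_mul_add_one j)]
    simp only [routhTable]
    ring_nf
  | more i ih ih' => rw [routhTable, ih, ih, ih', ih', ← routhTable]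

/-- A Hurwitz (stable) polynomial: all its complex roots lie in the open left half-plane. The zero
polynomial is excluded, since it vanishes everywhere. -/
def IsHurwitzPoly (q : ℝ[X]) : Prop :=
  ∀ z : ℂ, aeval z q = 0 → z.re < 0

theorem norm_neg_conj_sub_le_norm_sub {s a : ℂ} (hs : 0 ≤ s.re) (ha : a.re ≤ 0) :
    ‖-conj s - a‖ ≤ ‖s - a‖ := by
  rw [← sq_le_sq₀ (norm_nonneg _) (norm_nonneg _), Complex.sq_norm, Complex.sq_norm]
  simp only [Complex.normSq_apply, Complex.sub_re, Complex.sub_im, Complex.neg_re, Complex.neg_im,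
    Complex.conj_re, Complex.conj_im]
  nlinarith [mul_nonneg hs (neg_nonneg.2 ha)]

theorem norm_sub_one_lt_norm_one_add {w : ℂ} (hw : 0 < w.re) : ‖w - 1‖ < ‖1 + w‖ := by
  rw [← sq_lt_sq₀ (norm_nonneg _) (norm_nonneg _), Complex.sq_norm, Complex.sq_norm]
  simp only [Complex.normSq_apply, Complex.sub_re, Complex.sub_im, Complex.add_re, Complex.add_im,
    Complex.one_re, Complex.one_im]
  linarith

theorem norm_eval_neg_conj_le {q : ℂ[X]} (hq : ∀ a ∈ q.roots, a.re ≤ 0) {s : ℂ}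
    (hs : 0 ≤ s.re) : ‖q.eval (-conj s)‖ ≤ ‖q.eval s‖ := by
  have norm_eval (z : ℂ) :
      ‖q.eval z‖ = ‖q.leadingCoeff‖ * (q.roots.map fun a => ‖z - a‖).prod := by
    rw [(IsAlgClosed.splits q).eval_eq_prod_roots z, norm_mul]
    congr 1
    exact (map_multiset_prod (normHom : ℂ →*₀ ℝ) _).trans (by simp only [Multiset.map_map]; rfl)
  rw [norm_eval, norm_eval]
  exact mul_le_mul_of_nonneg_left (Multiset.prod_map_le_prod_map₀ _ _ (fun _ _ => norm_nonneg _)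
    fun a ha => norm_neg_conj_sub_le_norm_sub hs (hq a ha)) (norm_nonneg _)

theorem IsHurwitzPoly.norm_aeval_neg_le {q : ℝ[X]} (hq : IsHurwitzPoly q) {s : ℂ}
    (hs : 0 ≤ s.re) : ‖aeval (-s) q‖ ≤ ‖aeval s q‖ := by
  have hroots : ∀ a ∈ q.aroots ℂ, a.re ≤ 0 := fun a ha => (hq a (mem_aroots'.1 ha).2).le
  calc ‖aeval (-s) q‖ = ‖aeval (-conj s) q‖ := by rw [← map_neg, aeval_conj, RCLike.norm_conj]
    _ ≤ ‖aeval s q‖ := by simpa only [eval_map_algebraMap] using norm_eval_neg_conj_le hroots hs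

theorem isHurwitzPoly_descPoly_succ {N : ℕ} {c : ℕ → ℝ} (h₀ : 0 ≤ c 0) (h₁ : 0 < c 1)
    (hc : c (N + 2) = 0) (hQ : IsHurwitzPoly (descPoly N (routhReduce c))) :
    IsHurwitzPoly (descPoly (N + 1) c) := by
  intro z hz
  by_contra! hre
  set Q := descPoly N (routhReduce c)
  set w : ℂ := c 1 + c 0 * z with hw
  have hwre : 0 < w.re := by
    simp only [hw, Complex.add_re, Complex.ofReal_re, Complex.re_ofReal_mul]
    positivity
  have hQz : 0 < ‖aeval z Q‖ := norm_pos_iff.2 fun h => (hQ z h).not_ge hre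
  have hstep : (1 + w) * aeval z Q + (w - 1) * ((-1) ^ N * aeval (-z) Q) = 0 := by
    simpa [hz, hc, aeval_comp] using (congrArg (aeval z) (two_mul_descPoly_succ N c)).symm
  have hnorm : ‖1 + w‖ * ‖aeval z Q‖ = ‖w - 1‖ * ‖aeval (-z) Q‖ := by
    simpa using congrArg norm (eq_neg_of_add_eq_zero_left hstep)
  exact lt_irrefl _ <| calc
    ‖w - 1‖ * ‖aeval z Q‖ < ‖1 + w‖ * ‖aeval z Q‖ :=
      mul_lt_mul_of_pos_right (norm_sub_one_lt_norm_one_add hwre) hQz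
    _ = ‖w - 1‖ * ‖aeval (-z) Q‖ := hnorm
    _ ≤ ‖w - 1‖ * ‖aeval z Q‖ :=
      mul_le_mul_of_nonneg_left (hQ.norm_aeval_neg_le hre) (norm_nonneg _)

theorem isHurwitzPoly_descPoly_of_routhTable_pos {N : ℕ} {c : ℕ → ℝ} (hc : ∀ k, N < k → c k = 0)
    (hpos : ∀ i < N, 0 < routhTable c i 0) (hlast : 0 < c N) : IsHurwitzPoly (descPoly N c) := by
  induction N generalizing c with
  | zero =>
    intro z hz
    rw [descPoly_zero, aeval_C] at hz
    exact absurd hz (by simpa using hlast.ne')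
  | succ N ih =>
    have h₀ : 0 < c 0 := by simpa [routhTable] using hpos 0 N.succ_pos
    have h₁ : 0 < c 1 := by
      rcases N.eq_zero_or_pos with rfl | hN
      · exact hlast
      · simpa [routhTable] using hpos 1 (by omega)
    have hc' : c (N + 2) = 0 := hc _ (by omega)
    refine isHurwitzPoly_descPoly_succ h₀.le h₁ hc'
      (ih (fun k hk => ?_) (fun i hi => ?_) ?_)
    · simp [routhReduce, hc (k + 1) (by omega), hc (k + 2) (by omega)]
    · rw [routhTable_routhReduce]
      exact hpos _ (by omega)
    · rw [routhReduce, hc']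
      split_ifs
      · exact hlast
      · simpa using mul_pos h₁ hlast

section RouthHurwitz

variable {n : ℕ} {M : Matrix (Fin n) (Fin n) ℝ}

theorem charCoeff_of_lt {k : ℕ} (hk : n < k) : charCoeff M k = 0 :=
  if_neg hk.not_ge

theorem charCoeff_zero : charCoeff M 0 = 1 := by
  simpa [charCoeff, Polynomial.leadingCoeff] using M.charpoly_monic.leadingCoeff

theorem descPoly_charCoeff : descPoly n (charCoeff M) = M.charpoly := by
  have hdeg : M.charpoly.natDegree = n := by simp
  conv_rhs => rw [← descPoly_coeff_natDegree_sub M.charpoly, hdeg]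
  refine Finset.sum_congr rfl fun k hk => ?_
  rw [charCoeff, if_pos (Nat.lt_succ_iff.1 (Finset.mem_range.1 hk))]

theorem isHurwitz_iff_isHurwitzPoly_charpoly : IsHurwitz M ↔ IsHurwitzPoly M.charpoly := by
  refine forall_congr' fun z => imp_congr_left ?_
  rw [Matrix.mem_spectrum_iff_isRoot_charpoly, IsRoot.def, ← eval_map_algebraMap,
    ← Matrix.charpoly_map]
  rfl

/-- The value at `M` of the Routh–Hurwitz polynomial `f_{i+1}`, so that
`S.routhPoly i K ρ = routhHurwitz (S.closedLoop K ρ) i` by definition. -/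
noncomputable def routhHurwitz (M : Matrix (Fin n) (Fin n) ℝ) (i : Fin n) : ℝ :=
  if (i : ℕ) + 1 = n then charCoeff M n else routhTable (charCoeff M) ((i : ℕ) + 1) 0

theorem isHurwitz_of_routhHurwitz_pos (hpos : ∀ i, 0 < routhHurwitz M i) : IsHurwitz M := by
  rw [isHurwitz_iff_isHurwitzPoly_charpoly, ← descPoly_charCoeff]
  refine isHurwitzPoly_descPoly_of_routhTable_pos (fun k hk => charCoeff_of_lt hk)
    (fun i hi => ?_) ?_
  · rcases i with _ | i
    · simp [routhTable, charCoeff_zero]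
    · simpa [routhHurwitz, hi.ne] using hpos ⟨i, by omega⟩
  · rcases n with _ | n
    · simp [charCoeff_zero]
    · simpa [routhHurwitz] using hpos (Fin.last n)

end RouthHurwitz

section Frobenius

attribute [local instance] Matrix.frobeniusNormedAddCommGroup

variable {n m : ℕ}

theorem frobNorm_nonneg (K : Matrix (Fin m) (Fin n) ℝ) : 0 ≤ frobNorm K :=
  norm_nonneg K

theorem frobNorm_zero : frobNorm (0 : Matrix (Fin m) (Fin n) ℝ) = 0 :=
  norm_zero

end Frobenius

section DistanceToViolation

variable {n m : ℕ} {Θ : Type*}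

/-- The feasible set of the `i`-th problem for an arbitrary matrix family `M K ρ` in place of
`A(ρ) - B K`: triples `(K_P, K_C, ρ)` in which `K_P` violates the `i`-th Routh–Hurwitz inequality at
`ρ ∈ P` and `vec K_C ∈ C`. -/
def violationSet (M : Matrix (Fin m) (Fin n) ℝ → Θ → Matrix (Fin n) (Fin n) ℝ) (P : Set Θ)
    (C : Set (Fin n × Fin m → ℝ)) (i : Fin n) :
    Set (Matrix (Fin m) (Fin n) ℝ × Matrix (Fin m) (Fin n) ℝ × Θ) :=
  {z | routhHurwitz (M z.1 z.2.2) i ≤ 0 ∧ z.2.1.vec ∈ C ∧ z.2.2 ∈ P}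

/-- The optimal value `dᵢ` for an arbitrary matrix family. If `violationSet M P C i` is empty, this
is `0` by the convention for `sInf ∅`, rather than `+∞`. -/
noncomputable def violationDist (M : Matrix (Fin m) (Fin n) ℝ → Θ → Matrix (Fin n) (Fin n) ℝ)
    (P : Set Θ) (C : Set (Fin n × Fin m → ℝ)) (i : Fin n) : ℝ :=
  sInf ((fun z => frobNorm (z.2.1 - z.1)) '' violationSet M P C i)

variable {M : Matrix (Fin m) (Fin n) ℝ → Θ → Matrix (Fin n) (Fin n) ℝ} {P : Set Θ}
  {C : Set (Fin n × Fin m → ℝ)} {i : Fin n}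

theorem violationDist_le {K_P K_C : Matrix (Fin m) (Fin n) ℝ} {ρ : Θ}
    (h : (K_P, K_C, ρ) ∈ violationSet M P C i) : violationDist M P C i ≤ frobNorm (K_C - K_P) :=
  csInf_le ⟨0, Set.forall_mem_image.2 fun _ _ => frobNorm_nonneg _⟩ ⟨_, h, rfl⟩

theorem routhHurwitz_pos_of_violationDist_pos
    (hpos : (violationSet M P C i).Nonempty → 0 < violationDist M P C i)
    {K : Matrix (Fin m) (Fin n) ℝ} (hK : K.vec ∈ C) {ρ : Θ} (hρ : ρ ∈ P) :
    0 < routhHurwitz (M K ρ) i := by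
  by_contra! hviol
  have hmem : (K, K, ρ) ∈ violationSet M P C i := ⟨hviol, hK, hρ⟩
  have hle := violationDist_le hmem
  rw [sub_self, frobNorm_zero] at hle
  exact hle.not_gt (hpos ⟨_, hmem⟩)

end DistanceToViolation

end LPVGain

theorem mainTheorem9_general {n m : ℕ} {Θ : Type*}
    (M : Matrix (Fin m) (Fin n) ℝ → Θ → Matrix (Fin n) (Fin n) ℝ) (P : Set Θ)
    (C : Set (Fin n × Fin m → ℝ))
    (hpos : ∀ i, (LPVGain.violationSet M P C i).Nonempty → 0 < LPVGain.violationDist M P C i) :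
    C ⊆ Matrix.vec '' ⋂ ρ ∈ P, {K | LPVGain.IsHurwitz (M K ρ)} := by
  intro v hv
  obtain ⟨K, rfl⟩ := Matrix.vec_bijective.surjective v
  refine ⟨K, Set.mem_iInter₂.2 fun ρ hρ => ?_, rfl⟩
  exact LPVGain.isHurwitz_of_routhHurwitz_pos fun i =>
    LPVGain.routhHurwitz_pos_of_violationDist_pos (hpos i) hv hρ

theorem mainTheorem9 {n m p : ℕ} (S : LPVGain.PolytopicLPV n m p) (lo hi : Fin n × Fin m → ℝ)
    (hfeas : ∀ i : Fin n, (S.feasibleSet (LPVGain.hyperrectangle lo hi) i).Nonempty)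
    (hpos : ∀ i : Fin n, 0 < S.optValue (LPVGain.hyperrectangle lo hi) i) :
    LPVGain.hyperrectangle lo hi ⊆ Matrix.vec '' S.robustRegion :=
  mainTheorem9_general S.closedLoop S.P _ fun i _ => hpos i
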